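/- Fix an integer $d \ge 1$. Let $d\mathcal Z$ be the class of $d$ differently coloured atoms of size $1$, and for $n\ge 1$ let $\mathcal C_n = \mathrm{MSet}(\mathrm{MSet}_{1..n}(d\mathcal Z))$ be the combinatorial class of all finite multisets of multisets of $d$ coloured atoms of cardinality between $1$ and $n$; the size $|\gamma|$ of $\gamma \in \mathcal C_n$ is its total number of atoms, with multiplicity. (Its generating function is $\prod_{k=1}^n (1-z^k)^{-\binom{k+d-1}{d-1}}$.) For $\lambda \in (0,1)$ let $U_n$ be the size of an object drawn from the Boltzmann distribution $\mathbb P_\lambda(\gamma) = \lambda^{|\gamma|} / \sum_{\gamma'\in\mathcal C_n} \lambda^{|\gamma'|}$ on $\mathcal C_n$. For $r\ge 1$ and $\lambda\in(0,1)$ let $\mathrm{NegativeBinomial}(r,\lambda)$ be the distribution on $\mathbb Z_{\ge 0}$ with mass $\binom{k+r-1}{r-1}\lambda^k(1-\lambda)^r$ at $k$, and let $\mathrm{NegativeBinomial}_{\ge 1}(r,\lambda)$ be this distribution conditioned on being at least $1$. Lemma. For all sufficiently large $n$ (depending only on $d$), the equation $\mathbb E_{\lambda}[U_n] = n$ has exactly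 one solution $\lambda = \lambda_n \in (0,1)$, and the following hold. 1. For every $k \in \{1,\dots,n\}$, a random variable $V \sim \mathrm{NegativeBinomial}_{\ge 1}(d, \lambda_n^k)$ satisfies $\mathbb P(V \le n) \ge \tfrac12$. 2. Consequently the rejection loop of the multiset sampler $\Gamma\mathrm{MSet}_{1..n}(d\mathcal Z)(\lambda_n^k)$, which draws independent samples $m \sim \mathrm{NegativeBinomial}_{\ge 1}(d,\lambda_n^k)$ until $m \le n$, takes $O(1)$ trials in expectation, namely at most $2$, for every integer $k \ge 1$. -/

import Mathlib

open MeasureTheory ProbabilityTheory Filter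
open scoped ENNReal

/-- A combinatorial class: a set of objects with a size function such that there are only
finitely many objects of any given size. -/
structure CombClass where
  /-- the objects -/
  Obj : Type
  /-- the size function -/
  size : Obj → ℕ
  /-- finitely many objects of each size -/
  finite_size : ∀ m : ℕ, {a : Obj | size a = m}.Finite

namespace CombClass

/-- The class `dZ` of `d` differently coloured atoms, all of size `1`. -/
def atoms (d : ℕ) : CombClass where
  Obj := Fin d
  size := fun _ => 1
  finite_size := fun _ => Set.toFinite _

/-- The class `MSet(B)` of all finite multisets of objects of a class `B` that has no object of
size `0`; the size of a multiset is the sum of the sizes of its members, with multiplicity. -/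
def mset (B : CombClass) (hB : ∀ b : B.Obj, 0 < B.size b) : CombClass where
  Obj := Multiset B.Obj
  size := fun s => (s.map B.size).sum
  finite_size := by
    classical
    intro m
    have hT : {b : B.Obj | B.size b ≤ m}.Finite := by
      have h : {b : B.Obj | B.size b ≤ m} = ⋃ i ∈ Finset.range (m + 1), {b | B.size b = i} := by
        ext b
        simp
      rw [h]
      exact (Finset.range (m + 1)).finite_toSet.biUnion fun i _ => B.finite_size i
    refine (Set.finite_Iic (m • hT.toFinset.val)).subset ?_
    intro s hs
    have hs' : (s.map B.size).sum = m := hs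
    have hcard : Multiset.card s ≤ m := by
      have h := Multiset.card_nsmul_le_sum (s := s.map B.size) (a := 1) (by
        intro x hx
        obtain ⟨b, -, rfl⟩ := Multiset.mem_map.1 hx
        exact hB b)
      simpa [hs'] using h
    rw [Set.mem_Iic, Multiset.le_iff_count]
    intro b
    by_cases hb : b ∈ s
    · have hbm : B.size b ≤ m := hs' ▸ Multiset.single_le_sum (fun _ _ => Nat.zero_le _) _
        (Multiset.mem_map_of_mem _ hb)
      have h1 : Multiset.count b hT.toFinset.val = 1 :=
        Multiset.count_eq_one_of_mem hT.toFinset.nodup (by simpa using hbm)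
      rw [Multiset.count_nsmul, h1, mul_one]
      exact (Multiset.count_le_card b s).trans hcard
    · simp [Multiset.count_eq_zero_of_notMem hb]

/-- The subclass of the objects of `C` whose size lies in `{1, ..., n}`. -/
def sizeOneTo (C : CombClass) (n : ℕ) : CombClass where
  Obj := {a : C.Obj // 1 ≤ C.size a ∧ C.size a ≤ n}
  size := fun a => C.size a.1
  finite_size := fun m => (C.finite_size m).preimage Subtype.val_injective.injOn

/-- The ordinary generating function `C(z) = ∑_γ z ^ |γ|`, as a function of a real variable. -/
noncomputable def genFun (C : CombClass) (z : ℝ) : ℝ := ∑' γ : C.Obj, z ^ C.size γ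

/-- The Boltzmann distribution of `C` with parameter `l`: `P_l(γ) = l ^ |γ| / C(l)`. -/
noncomputable def boltzmann (C : CombClass) (l : ℝ) (γ : C.Obj) : ℝ :=
  l ^ C.size γ / C.genFun l

/-- The expected size `E_l[U]` of an object drawn from the Boltzmann distribution of `C` with
parameter `l`. -/
noncomputable def expectedSize (C : CombClass) (l : ℝ) : ℝ :=
  ∑' γ : C.Obj, (C.size γ : ℝ) * C.boltzmann l γ

/-- `MSet_{1..n}(dZ)`: the multisets of `d` coloured atoms of cardinality between `1` and `n`. -/
def summands (d n : ℕ) : CombClass :=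
  ((atoms d).mset fun _ => Nat.one_pos).sizeOneTo n

/-- `MSet(MSet_{1..n}(dZ))`: the weighted partitions into parts of size at most `n`, with
`(k + d - 1).choose (d - 1)` types of parts of size `k`. -/
def truncatedBEC (d n : ℕ) : CombClass :=
  (summands d n).mset fun b => b.2.1

end CombClass

/-- `l` is the tuned parameter `λ_n`: a parameter of the Boltzmann distribution of
`MSet(MSet_{1..n}(dZ))`, whose generating function `∏_{k ≤ n} (1 - z ^ k) ^ (-b_k)` has radius of
convergence `1` (for `n ≥ 1`), at which the expected size is `n`. -/
def IsTuned (d n : ℕ) (l : ℝ) : Prop :=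
  0 < l ∧ l < 1 ∧ (CombClass.truncatedBEC d n).expectedSize l = n

/-- The distribution `NegativeBinomial(r, l)` on `ℕ`, with mass
`(k + r - 1).choose (r - 1) * l ^ k * (1 - l) ^ r` at `k`, for `r ≥ 1`. -/
noncomputable def negativeBinomial (r : ℕ) (l : ℝ) : Measure ℕ :=
  Measure.sum fun k : ℕ =>
    ENNReal.ofReal (((k + r - 1).choose (r - 1) : ℝ) * l ^ k * (1 - l) ^ r) • Measure.dirac k

/-- The zero-truncated distribution `NegativeBinomial_{≥ 1}(r, l)`: the negative binomial
distribution conditioned on being at least `1`. -/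
noncomputable def negativeBinomialPos (r : ℕ) (l : ℝ) : Measure ℕ :=
  ProbabilityTheory.cond (negativeBinomial r l) (Set.Ici 1)

/-- The number of trials made by the loop "repeat draw `m` until `m ≤ n`" when the successive
draws are `v 0, v 1, ...`; it is `∞` if the loop does not stop. -/
noncomputable def numTrials (n : ℕ) (v : ℕ → ℕ) : ℝ≥0∞ :=
  ⨅ (i : ℕ) (_ : v i ≤ n), ((i : ℝ≥0∞) + 1)

/-!
A multiset is determined by its multiplicities, which are independent geometric variables under
the Boltzmann distribution: a part `b` occurs `z ^ |b| / (1 - z ^ |b|)` times on average. Hence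
`E_z[U] = ∑_{k ≤ n} b_k k z ^ k / (1 - z ^ k)`, where `b_k` is the number of parts of size `k`,
and this increases continuously from `0` to `∞` on `[0, 1)`.

Bernoulli's inequality `1 - z ^ k ≤ k (1 - z)` makes every term at least `z ^ k / (1 - z)`, so
`m z ^ m ≤ (1 - z) E_z[U]` for `m ≤ n`. At `z = λ_n` and `m = ⌊√n⌋` this forces
`n (1 - λ_n) ≥ ⌊√n⌋ / 2`. A zero-truncated negative binomial variable with parameters `d`, `q` has
mean at most `d / (1 - q)`, and `1 - λ_n ^ k ≥ 1 - λ_n`, so by Markov's inequality a draw exceeds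
`n` with probability at most `2 d / ⌊√n⌋`, uniformly in `k ≥ 1`. The number of trials is then
dominated by a geometric variable.
-/

section MultisetSums

variable {R : Type*} [NormedCommRing R] [CompleteSpace R]

theorem summable_norm_and_hasSum_pi_fin_prod {n : ℕ} {κ : Fin n → Type*} {g : ∀ i, κ i → R}
    {c : Fin n → R} (hg : ∀ i, Summable fun k => ‖g i k‖) (hc : ∀ i, HasSum (g i) (c i)) :
    (Summable fun f : ∀ i, κ i => ‖∏ i, g i (f i)‖) ∧
      HasSum (fun f : ∀ i, κ i => ∏ i, g i (f i)) (∏ i, c i) := by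
  induction n with
  | zero => simp [Summable.of_finite, hasSum_unique]
  | succ n ih =>
    obtain ⟨hsum, hhas⟩ := ih (fun i => hg i.succ) fun i => hc i.succ
    have hnorm := (hg 0).mul_norm hsum
    rw [← (Fin.consEquiv κ).summable_iff, ← (Fin.consEquiv κ).hasSum_iff]
    simpa [Function.comp_def, Fin.prod_univ_succ, Fin.consEquiv] using
      And.intro hnorm ((hc 0).mul hhas hnorm.of_norm)

variable {ι : Type*} [Fintype ι]

theorem hasSum_pi_prod {κ : ι → Type*} {g : ∀ i, κ i → R} {c : ι → R}
    (hg : ∀ i, Summable fun k => ‖g i k‖) (hc : ∀ i, HasSum (g i) (c i)) :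
    HasSum (fun f : ∀ i, κ i => ∏ i, g i (f i)) (∏ i, c i) := by
  let e := (Fintype.equivFin ι).symm
  have h := (summable_norm_and_hasSum_pi_fin_prod (fun i => hg (e i)) fun i => hc (e i)).2
  rw [← (Equiv.piCongrLeft κ e).hasSum_iff]
  simpa only [Function.comp_def, ← e.prod_comp, Equiv.piCongrLeft_apply_apply] using h

variable [DecidableEq ι]

theorem hasSum_multiset_prod_count {g : ι → ℕ → R} {c : ι → R}
    (hg : ∀ i, Summable fun k => ‖g i k‖) (hc : ∀ i, HasSum (g i) (c i)) :
    HasSum (fun s : Multiset ι => ∏ i, g i (s.count i)) (∏ i, c i) := by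
  let e : Multiset ι ≃ (ι → ℕ) := Multiset.toFinsupp.toEquiv.trans Finsupp.equivFunOnFinite
  have h := e.hasSum_iff.2 (hasSum_pi_prod hg hc)
  simpa [Function.comp_def, e] using h

theorem multiset_sum_map_eq_sum_count {M : Type*} [AddCommMonoid M] (w : ι → M)
    (s : Multiset ι) : (s.map w).sum = ∑ i, s.count i • w i := by
  rw [Finset.sum_multiset_map_count]
  refine Finset.sum_subset (Finset.subset_univ _) fun i _ hi => ?_
  rw [Multiset.count_eq_zero_of_notMem (by simpa using hi), zero_smul]

theorem pow_multiset_sum_map {M : Type*} [CommMonoid M] (z : M) (w : ι → ℕ) (s : Multiset ι) :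
    z ^ (s.map w).sum = ∏ i, (z ^ w i) ^ s.count i := by
  simp only [multiset_sum_map_eq_sum_count, smul_eq_mul, Finset.prod_pow_eq_pow_sum, ← pow_mul,
    mul_comm (w _)]

theorem hasSum_multiset_prod_pow_count {a : ι → ℝ} (h0 : ∀ i, 0 ≤ a i) (h1 : ∀ i, a i < 1) :
    HasSum (fun s : Multiset ι => ∏ i, a i ^ s.count i) (∏ i, (1 - a i)⁻¹) := by
  have hc := fun i => hasSum_geometric_of_lt_one (h0 i) (h1 i)
  exact hasSum_multiset_prod_count (fun i => (hc i).summable.norm) hc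

theorem hasSum_multiset_count_mul_prod_pow_count {a : ι → ℝ} (h0 : ∀ i, 0 ≤ a i)
    (h1 : ∀ i, a i < 1) (b : ι) :
    HasSum (fun s : Multiset ι => s.count b * ∏ i, a i ^ s.count i)
      (a b / (1 - a b) * ∏ i, (1 - a i)⁻¹) := by
  let g (i : ι) (k : ℕ) : ℝ := (if i = b then (k : ℝ) else 1) * a i ^ k
  have hc (i : ι) : HasSum (g i) ((if i = b then a i / (1 - a i) else 1) * (1 - a i)⁻¹) := by
    by_cases hi : i = b
    · have := hasSum_coe_mul_geometric_of_norm_lt_one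
        (by rw [Real.norm_of_nonneg (h0 i)]; exact h1 i)
      simpa [g, hi, sq, ← div_div, ← div_eq_mul_inv] using this
    · simpa [g, hi] using hasSum_geometric_of_lt_one (h0 i) (h1 i)
  simpa only [g, Finset.prod_mul_distrib, Finset.prod_ite_eq', Finset.mem_univ, if_true] using
    hasSum_multiset_prod_count (fun i => (hc i).summable.norm) hc

end MultisetSums

namespace CombClass

section Mset

variable (B : CombClass) [Fintype B.Obj] (hB : ∀ b : B.Obj, 0 < B.size b) {z : ℝ}

theorem size_mset [DecidableEq B.Obj] (s : (B.mset hB).Obj) :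
    (B.mset hB).size s = ∑ b, Multiset.count (α := B.Obj) b s * B.size b :=
  multiset_sum_map_eq_sum_count B.size s

theorem genFun_mset (h0 : 0 ≤ z) (h1 : z < 1) :
    (B.mset hB).genFun z = ∏ b : B.Obj, (1 - z ^ B.size b)⁻¹ := by
  classical
  have hsum := hasSum_multiset_prod_pow_count (fun b => pow_nonneg h0 (B.size b))
    fun b => pow_lt_one₀ h0 h1 (hB b).ne'
  simp only [← pow_multiset_sum_map] at hsum
  exact hsum.tsum_eq

/-- By linearity: each `b` occurs `z ^ |b| / (1 - z ^ |b|)` times on average. -/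
theorem expectedSize_mset (h0 : 0 ≤ z) (h1 : z < 1) :
    (B.mset hB).expectedSize z = ∑ b : B.Obj, B.size b * (z ^ B.size b / (1 - z ^ B.size b)) := by
  classical
  have hlt (b : B.Obj) : z ^ B.size b < 1 := pow_lt_one₀ h0 h1 (hB b).ne'
  have hgen : (B.mset hB).genFun z ≠ 0 := by
    rw [genFun_mset B hB h0 h1]
    exact (Finset.prod_pos fun b _ => inv_pos.2 (sub_pos.2 (hlt b))).ne'
  have hcount := hasSum_sum (s := Finset.univ) fun b _ =>
    (hasSum_multiset_count_mul_prod_pow_count (fun b => pow_nonneg h0 (B.size b)) hlt b).mul_left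
      (B.size b : ℝ)
  simp only [← pow_multiset_sum_map, ← genFun_mset B hB h0 h1, ← mul_assoc, ← Finset.sum_mul]
    at hcount
  have hsize (s : (B.mset hB).Obj) : ((B.mset hB).size s : ℝ) =
      ∑ b, B.size b * (Multiset.count (α := B.Obj) b s : ℝ) := by
    rw [size_mset, Nat.cast_sum]
    simp only [Nat.cast_mul, mul_comm]
  have hmean : HasSum (fun s => ((B.mset hB).size s : ℝ) * z ^ (B.mset hB).size s)
      ((∑ b, B.size b * (z ^ B.size b / (1 - z ^ B.size b))) * (B.mset hB).genFun z) := by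
    simp only [hsize]
    exact hcount
  simpa only [expectedSize, boltzmann, mul_div_assoc, div_self hgen, mul_one] using
    (hmean.div_const ((B.mset hB).genFun z)).tsum_eq

end Mset

theorem size_summands {d n : ℕ} (b : (summands d n).Obj) :
    (summands d n).size b = Multiset.card (α := Fin d) b.1 := by
  simp [summands, sizeOneTo, mset, atoms]

/-- The parts of size `k` are the multisets of `k` colours, that is, the elements of
`Sym (Fin d) k`. -/
def summandsEquiv (d n : ℕ) : (summands d n).Obj ≃ Σ k : Finset.Icc 1 n, Sym (Fin d) k where
  toFun b := ⟨⟨Multiset.card (α := Fin d) b.1,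
    Finset.mem_Icc.2 (size_summands b ▸ b.2)⟩, ⟨b.1, rfl⟩⟩
  invFun p := ⟨p.2.1, by
    have := Finset.mem_Icc.1 p.1.2
    simpa [mset, atoms] using this⟩
  left_inv _ := rfl
  right_inv := by
    rintro ⟨⟨k, _⟩, ⟨s, hs⟩⟩
    change s.card = k at hs
    subst hs
    rfl

theorem expectedSize_truncatedBEC (d n : ℕ) {z : ℝ} (h0 : 0 ≤ z) (h1 : z < 1) :
    (truncatedBEC d n).expectedSize z =
      ∑ k ∈ Finset.Icc 1 n, d.multichoose k * (k * (z ^ k / (1 - z ^ k))) := by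
  let := Fintype.ofEquiv _ (summandsEquiv d n).symm
  calc (truncatedBEC d n).expectedSize z
      = ∑ b, (summands d n).size b *
          (z ^ (summands d n).size b / (1 - z ^ (summands d n).size b)) :=
        expectedSize_mset (summands d n) (fun b => b.2.1) h0 h1
    _ = ∑ p : Σ k : Finset.Icc 1 n, Sym (Fin d) k, p.1 * (z ^ (p.1 : ℕ) / (1 - z ^ (p.1 : ℕ))) :=
        Fintype.sum_equiv (summandsEquiv d n) _ _ fun b => by rw [size_summands]; rfl
    _ = ∑ k ∈ Finset.Icc 1 n, d.multichoose k * (k * (z ^ k / (1 - z ^ k))) := by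
        rw [Fintype.sum_sigma]
        simp only [Finset.sum_const, Finset.card_univ, Sym.card_sym_fin_eq_multichoose,
          nsmul_eq_mul]
        exact Finset.sum_coe_sort (Finset.Icc 1 n)
          fun k => (d.multichoose k : ℝ) * (k * (z ^ k / (1 - z ^ k)))

end CombClass

theorem strictMonoOn_div_one_sub : StrictMonoOn (fun x : ℝ => x / (1 - x)) (Set.Iio 1) := by
  intro x hx y hy hxy
  have hx' : 0 < 1 - x := sub_pos.2 hx
  have hy' : 0 < 1 - y := sub_pos.2 hy
  rw [div_lt_div_iff₀ hx' hy']
  linarith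

theorem one_sub_pow_le_mul_one_sub {z : ℝ} (h0 : 0 ≤ z) (k : ℕ) : 1 - z ^ k ≤ k * (1 - z) := by
  have := one_add_mul_le_pow (a := z - 1) (by linarith) k
  rw [add_sub_cancel] at this
  linarith

theorem pow_le_one_sub_mul_mul_pow_div {z : ℝ} (h0 : 0 ≤ z) (h1 : z < 1) {k : ℕ} (hk : k ≠ 0) :
    z ^ k ≤ (1 - z) * (k * (z ^ k / (1 - z ^ k))) := by
  have hpos : 0 < 1 - z ^ k := sub_pos.2 (pow_lt_one₀ h0 h1 hk)
  calc z ^ k = (1 - z ^ k) * (z ^ k / (1 - z ^ k)) := (mul_div_cancel₀ _ hpos.ne').symm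
    _ ≤ k * (1 - z) * (z ^ k / (1 - z ^ k)) := by
      gcongr
      exact one_sub_pow_le_mul_one_sub h0 k
    _ = (1 - z) * (k * (z ^ k / (1 - z ^ k))) := by ring

theorem one_le_multichoose {d : ℕ} (hd : 1 ≤ d) (k : ℕ) : 1 ≤ d.multichoose k := by
  rw [Nat.multichoose_eq]
  exact Nat.choose_pos (by omega)

namespace CombClass

variable {d n : ℕ} {z : ℝ}

theorem expectedSize_truncatedBEC_zero : (truncatedBEC d n).expectedSize 0 = 0 := by
  rw [expectedSize_truncatedBEC d n le_rfl one_pos]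
  refine Finset.sum_eq_zero fun k hk => ?_
  simp [zero_pow (Nat.one_le_iff_ne_zero.1 (Finset.mem_Icc.1 hk).1)]

theorem continuousOn_expectedSize_truncatedBEC :
    ContinuousOn (truncatedBEC d n).expectedSize (Set.Ico 0 1) := by
  refine .congr ?_ fun x hx => expectedSize_truncatedBEC d n hx.1 hx.2
  refine continuousOn_finsetSum _ fun k hk =>
    continuousOn_const.mul (continuousOn_const.mul (.div (by fun_prop) (by fun_prop) ?_))
  have hk : k ≠ 0 := Nat.one_le_iff_ne_zero.1 (Finset.mem_Icc.1 hk).1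
  exact fun x hx => (sub_pos.2 (pow_lt_one₀ hx.1 hx.2 hk)).ne'

theorem strictMonoOn_expectedSize_truncatedBEC (hd : 1 ≤ d) (hn : 1 ≤ n) :
    StrictMonoOn (truncatedBEC d n).expectedSize (Set.Ico 0 1) := by
  intro x hx y hy hxy
  rw [expectedSize_truncatedBEC d n hx.1 hx.2, expectedSize_truncatedBEC d n hy.1 hy.2]
  refine Finset.sum_lt_sum_of_nonempty (Finset.nonempty_Icc.2 hn) fun k hk => ?_
  have hk : 0 < k := (Finset.mem_Icc.1 hk).1
  have hmul : (0 : ℝ) < d.multichoose k := mod_cast one_le_multichoose hd k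
  refine mul_lt_mul_of_pos_left (mul_lt_mul_of_pos_left ?_ (mod_cast hk)) hmul
  exact strictMonoOn_div_one_sub (pow_lt_one₀ hx.1 hx.2 hk.ne') (pow_lt_one₀ hy.1 hy.2 hk.ne')
    (pow_lt_pow_left₀ hxy hx.1 hk.ne')

theorem mul_pow_le_one_sub_mul_expectedSize (hd : 1 ≤ d) {m : ℕ} (hm : m ≤ n) (h0 : 0 ≤ z)
    (h1 : z < 1) : m * z ^ m ≤ (1 - z) * (truncatedBEC d n).expectedSize z := by
  have hz : 0 < 1 - z := sub_pos.2 h1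
  have hterm : ∀ k ∈ Finset.Icc 1 n,
      z ^ k ≤ (1 - z) * (d.multichoose k * (k * (z ^ k / (1 - z ^ k)))) := by
    intro k hk
    have hk : k ≠ 0 := Nat.one_le_iff_ne_zero.1 (Finset.mem_Icc.1 hk).1
    have hpos : 0 < 1 - z ^ k := sub_pos.2 (pow_lt_one₀ h0 h1 hk)
    refine (pow_le_one_sub_mul_mul_pow_div h0 h1 hk).trans ?_
    refine mul_le_mul_of_nonneg_left ?_ hz.le
    exact le_mul_of_one_le_left (by positivity) (mod_cast one_le_multichoose hd k)
  calc (m : ℝ) * z ^ m = ∑ _k ∈ Finset.Icc 1 m, z ^ m := by simp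
    _ ≤ ∑ k ∈ Finset.Icc 1 m, z ^ k :=
      Finset.sum_le_sum fun k hk => pow_le_pow_of_le_one h0 h1.le (Finset.mem_Icc.1 hk).2
    _ ≤ ∑ k ∈ Finset.Icc 1 n, z ^ k :=
      Finset.sum_le_sum_of_subset_of_nonneg (Finset.Icc_subset_Icc_right hm)
        fun k _ _ => pow_nonneg h0 k
    _ ≤ ∑ k ∈ Finset.Icc 1 n, (1 - z) * (d.multichoose k * (k * (z ^ k / (1 - z ^ k)))) :=
      Finset.sum_le_sum hterm
    _ = (1 - z) * (truncatedBEC d n).expectedSize z := by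
      rw [← Finset.mul_sum, expectedSize_truncatedBEC d n h0 h1]

end CombClass

section Tuned

open CombClass

variable {d n : ℕ}

theorem existsUnique_isTuned (hd : 1 ≤ d) (hn : 1 ≤ n) : ∃! l : ℝ, IsTuned d n l := by
  have hn0 : (0 : ℝ) < n := mod_cast hn
  set u : ℝ := n / (n + 1) with hu
  have hu0 : 0 ≤ u := by positivity
  have hu1 : u < 1 := (div_lt_one (by positivity)).2 (by linarith)
  have hlarge : (n : ℝ) ≤ (truncatedBEC d n).expectedSize u := by
    have h := mul_pow_le_one_sub_mul_expectedSize hd hn hu0 hu1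
    rw [Nat.cast_one, one_mul, pow_one, ← div_le_iff₀' (sub_pos.2 hu1)] at h
    have hodds : u / (1 - u) = n := by
      rw [hu]
      field_simp
      ring
    rwa [hodds] at h
  obtain ⟨l, hl, hln⟩ := intermediate_value_Icc hu0
    (continuousOn_expectedSize_truncatedBEC.mono fun x hx => ⟨hx.1, hx.2.trans_lt hu1⟩)
    (Set.mem_Icc.2 ⟨expectedSize_truncatedBEC_zero.trans_le hn0.le, hlarge⟩)
  have hl0 : 0 < l := by
    refine hl.1.lt_of_ne ?_
    rintro rfl
    exact hn0.ne (expectedSize_truncatedBEC_zero.symm.trans hln)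
  have hl1 : l < 1 := hl.2.trans_lt hu1
  exact ⟨l, ⟨hl0, hl1, hln⟩, fun y ⟨hy0, hy1, hyn⟩ =>
    (strictMonoOn_expectedSize_truncatedBEC hd hn).injOn ⟨hy0.le, hy1⟩ ⟨hl0.le, hl1⟩
      (hyn.trans hln.symm)⟩

theorem IsTuned.sqrt_le_two_mul_mul_one_sub {l : ℝ} (hl : IsTuned d n l) (hd : 1 ≤ d) :
    (n.sqrt : ℝ) ≤ 2 * (n * (1 - l)) := by
  obtain ⟨h0, h1, hmean⟩ := hl
  have : 0 < 1 - l := sub_pos.2 h1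
  have hsq : (n.sqrt : ℝ) * n.sqrt ≤ n := mod_cast Nat.sqrt_le n
  have hpow := one_sub_pow_le_mul_one_sub h0.le n.sqrt
  have hsum := mul_pow_le_one_sub_mul_expectedSize hd (Nat.sqrt_le_self n) h0.le h1
  rw [hmean] at hsum
  have hlow : n.sqrt - n * (1 - l) ≤ n.sqrt * l ^ n.sqrt := by
    calc n.sqrt - n * (1 - l) ≤ n.sqrt - n.sqrt * n.sqrt * (1 - l) := by gcongr
      _ = n.sqrt * (1 - n.sqrt * (1 - l)) := by ring
      _ ≤ n.sqrt * l ^ n.sqrt := by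
        gcongr
        linarith
  linarith

end Tuned

section NegativeBinomial

/-- The mass of `NegativeBinomial(r, q)` at `k`, kept real so that its moments are real series. -/
def negativeBinomialMass (r : ℕ) (q : ℝ) (k : ℕ) : ℝ :=
  ((k + r - 1).choose (r - 1) : ℝ) * q ^ k * (1 - q) ^ r

variable {r : ℕ} {q : ℝ}

theorem negativeBinomialMass_nonneg (h0 : 0 ≤ q) (h1 : q ≤ 1) (k : ℕ) :
    0 ≤ negativeBinomialMass r q k := by
  have : 0 ≤ 1 - q := sub_nonneg.2 h1
  unfold negativeBinomialMass
  positivity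

theorem hasSum_negativeBinomialMass (hr : 1 ≤ r) (h0 : 0 ≤ q) (h1 : q < 1) :
    HasSum (negativeBinomialMass r q) 1 := by
  obtain ⟨m, rfl⟩ := Nat.exists_eq_add_of_le' hr
  have hq : (1 - q) ^ (m + 1) ≠ 0 := pow_ne_zero _ (sub_pos.2 h1).ne'
  have h := (hasSum_choose_mul_geometric_of_norm_lt_one m (r := q)
    (by rwa [Real.norm_of_nonneg h0])).mul_right ((1 - q) ^ (m + 1))
  rwa [one_div_mul_cancel hq] at h

theorem succ_mul_negativeBinomialMass_succ (hr : 1 ≤ r) (h1 : q < 1) (k : ℕ) :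
    ((k + 1 : ℕ) : ℝ) * negativeBinomialMass r q (k + 1) =
      r * q / (1 - q) * negativeBinomialMass (r + 1) q k := by
  obtain ⟨m, rfl⟩ := Nat.exists_eq_add_of_le' hr
  have hq : 1 - q ≠ 0 := (sub_pos.2 h1).ne'
  have hchoose : ((k + 1 + m).choose m : ℝ) * (k + 1) =
      (k + 1 + m).choose (m + 1) * (m + 1) := by
    have := Nat.choose_succ_right_eq (k + 1 + m) m
    rw [Nat.add_sub_cancel] at this
    exact_mod_cast this.symm
  simp only [negativeBinomialMass, ← add_assoc, Nat.add_sub_cancel, add_right_comm k m 1]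
  field_simp
  push_cast
  linear_combination q ^ (k + 1) * (1 - q) ^ (m + 2) * hchoose

theorem hasSum_mul_negativeBinomialMass (hr : 1 ≤ r) (h0 : 0 ≤ q) (h1 : q < 1) :
    HasSum (fun k : ℕ => (k : ℝ) * negativeBinomialMass r q k) (r * q / (1 - q)) := by
  have h := (hasSum_negativeBinomialMass (Nat.le_add_left 1 r) h0 h1).mul_left (r * q / (1 - q))
  rw [← hasSum_nat_add_iff' 1]
  simpa [succ_mul_negativeBinomialMass_succ hr h1, -Nat.cast_add] using h

theorem isProbabilityMeasure_negativeBinomial (hr : 1 ≤ r) (h0 : 0 ≤ q) (h1 : q < 1) :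
    IsProbabilityMeasure (negativeBinomial r q) := by
  have h := hasSum_negativeBinomialMass hr h0 h1
  have htsum := ENNReal.ofReal_tsum_of_nonneg (negativeBinomialMass_nonneg h0 h1.le) h.summable
  rw [h.tsum_eq, ENNReal.ofReal_one] at htsum
  refine ⟨?_⟩
  rw [negativeBinomial, Measure.sum_apply _ MeasurableSet.univ]
  simp only [Measure.smul_apply, measure_univ, smul_eq_mul, mul_one]
  exact htsum.symm

theorem lintegral_negativeBinomial (hr : 1 ≤ r) (h0 : 0 ≤ q) (h1 : q < 1) :
    ∫⁻ k : ℕ, (k : ℝ≥0∞) ∂negativeBinomial r q = ENNReal.ofReal (r * q / (1 - q)) := by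
  have h := hasSum_mul_negativeBinomialMass hr h0 h1
  have hnonneg := negativeBinomialMass_nonneg (r := r) h0 h1.le
  rw [negativeBinomial, lintegral_sum_measure, ← h.tsum_eq,
    ENNReal.ofReal_tsum_of_nonneg (fun k => mul_nonneg k.cast_nonneg (hnonneg k)) h.summable]
  refine tsum_congr fun k => ?_
  rw [lintegral_smul_measure, lintegral_dirac, ENNReal.ofReal_mul k.cast_nonneg,
    ENNReal.ofReal_natCast, smul_eq_mul, mul_comm, negativeBinomialMass]

theorem negativeBinomial_singleton_zero :
    negativeBinomial r q {0} = ENNReal.ofReal ((1 - q) ^ r) := by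
  rw [negativeBinomial, Measure.sum_apply _ (measurableSet_singleton _), tsum_eq_single 0]
  · simp
  · intro k hk
    simp [hk]

theorem ofReal_le_negativeBinomial_Ici_one (hr : 1 ≤ r) (h0 : 0 ≤ q) (h1 : q < 1) :
    ENNReal.ofReal q ≤ negativeBinomial r q (Set.Ici 1) := by
  have := isProbabilityMeasure_negativeBinomial hr h0 h1
  have hset : (Set.Ici 1 : Set ℕ) = {0}ᶜ := by
    ext k
    simp [Nat.one_le_iff_ne_zero]
  have hpow : (1 - q) ^ r ≤ 1 - q :=
    pow_le_of_le_one (sub_nonneg.2 h1.le) (by linarith) (Nat.one_le_iff_ne_zero.1 hr)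
  rw [hset, prob_compl_eq_one_sub (measurableSet_singleton _), negativeBinomial_singleton_zero,
    ← ENNReal.ofReal_one, ← ENNReal.ofReal_sub _ (pow_nonneg (sub_nonneg.2 h1.le) _)]
  exact ENNReal.ofReal_le_ofReal (by linarith)

theorem lintegral_negativeBinomialPos_le (hr : 1 ≤ r) (h0 : 0 < q) (h1 : q < 1) :
    ∫⁻ k : ℕ, (k : ℝ≥0∞) ∂negativeBinomialPos r q ≤ ENNReal.ofReal (r / (1 - q)) := by
  calc ∫⁻ k : ℕ, (k : ℝ≥0∞) ∂negativeBinomialPos r q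
      = (negativeBinomial r q (Set.Ici 1))⁻¹ *
          ∫⁻ k in Set.Ici 1, (k : ℝ≥0∞) ∂negativeBinomial r q := by
        rw [negativeBinomialPos, ProbabilityTheory.cond, lintegral_smul_measure, smul_eq_mul]
    _ ≤ (ENNReal.ofReal q)⁻¹ * ENNReal.ofReal (r * q / (1 - q)) := by
        rw [← lintegral_negativeBinomial hr h0.le h1]
        gcongr
        · exact ofReal_le_negativeBinomial_Ici_one hr h0.le h1
        · exact Measure.restrict_le_self
    _ = ENNReal.ofReal (r / (1 - q)) := by
        rw [← ENNReal.ofReal_inv_of_pos h0, ← ENNReal.ofReal_mul (inv_nonneg.2 h0.le)]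
        congr 1
        field_simp

theorem negativeBinomialPos_Ioi_le (hr : 1 ≤ r) (h0 : 0 < q) (h1 : q < 1) {n : ℕ} {ε : ℝ}
    (hε : r ≤ ε * (n * (1 - q))) : negativeBinomialPos r q (Set.Ioi n) ≤ ENNReal.ofReal ε := by
  have : 0 < 1 - q := sub_pos.2 h1
  have hr0 : (0 : ℝ) < r := mod_cast hr
  have hn : n ≠ 0 := by
    rintro rfl
    simp [hr0.not_ge] at hε
  have hsub : Set.Ioi n ⊆ {k : ℕ | (n : ℝ≥0∞) ≤ k} :=
    fun k hk => by simpa using (Set.mem_Ioi.1 hk).le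
  calc negativeBinomialPos r q (Set.Ioi n)
      ≤ (∫⁻ k : ℕ, (k : ℝ≥0∞) ∂negativeBinomialPos r q) / n :=
        (measure_mono hsub).trans (meas_ge_le_lintegral_div (by fun_prop) (mod_cast hn)
          (ENNReal.natCast_ne_top n))
    _ ≤ ENNReal.ofReal (r / (1 - q)) / n := by
        gcongr
        exact lintegral_negativeBinomialPos_le hr h0 h1
    _ ≤ ENNReal.ofReal ε := by
        rw [← ENNReal.ofReal_natCast n, ← ENNReal.ofReal_div_of_pos (by positivity)]
        refine ENNReal.ofReal_le_ofReal ?_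
        rw [div_div, div_le_iff₀ (by positivity)]
        linarith

end NegativeBinomial

theorem IsTuned.negativeBinomialPos_Ioi_le {d n : ℕ} {l : ℝ} (hl : IsTuned d n l) (hd : 1 ≤ d)
    {ε : ℝ} (hε : 2 * d ≤ ε * n.sqrt) {k : ℕ} (hk : k ≠ 0) :
    negativeBinomialPos d (l ^ k) (Set.Ioi n) ≤ ENNReal.ofReal ε := by
  have hd0 : (0 : ℝ) < d := mod_cast hd
  have hε0 : 0 < ε := pos_of_mul_pos_left (by linarith) (Nat.cast_nonneg n.sqrt)
  refine _root_.negativeBinomialPos_Ioi_le hd (pow_pos hl.1 k) (pow_lt_one₀ hl.1.le hl.2.1 hk) ?_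
  calc (d : ℝ) ≤ ε * (n * (1 - l)) := by
        have := mul_le_mul_of_nonneg_left (hl.sqrt_le_two_mul_mul_one_sub hd) hε0.le
        linarith
    _ ≤ ε * (n * (1 - l ^ k)) := by
        gcongr
        exact pow_le_of_le_one hl.1.le hl.2.1.le hk

section RejectionLoop

/-- Layer-cake bound: the loop makes a trial number `j` (counted from `0`) only if all earlier
draws were rejected. -/
theorem numTrials_le_tsum (n : ℕ) (v : ℕ → ℕ) :
    numTrials n v ≤ ∑' j : ℕ, if ∀ i < j, n < v i then 1 else 0 := by
  by_cases h : ∃ i, v i ≤ n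
  · classical
    have hrejected : ∀ j ∈ Finset.range (Nat.find h + 1), ∀ i < j, n < v i :=
      fun j hj i hi => not_le.1 <| Nat.find_min h <|
        hi.trans_le <| Nat.lt_succ_iff.1 <| Finset.mem_range.1 hj
    calc numTrials n v ≤ (Nat.find h : ℝ≥0∞) + 1 :=
          iInf₂_le (f := fun i (_ : v i ≤ n) => (i : ℝ≥0∞) + 1) _ (Nat.find_spec h)
      _ = ∑ j ∈ Finset.range (Nat.find h + 1), if ∀ i < j, n < v i then 1 else 0 := by
        rw [Finset.sum_congr rfl fun j hj => if_pos (hrejected j hj)]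
        simp
      _ ≤ _ := ENNReal.sum_le_tsum _
  · push Not at h
    simp [h]

variable {Ω : Type*} [MeasurableSpace Ω] {P : Measure Ω}

theorem measure_biInter_preimage_le_pow {α : Type*} [MeasurableSpace α] {V : ℕ → Ω → α}
    (hind : iIndepFun V P) {s : Set α} (hs : MeasurableSet s) {p : ℝ≥0∞}
    (hp : ∀ i, P (V i ⁻¹' s) ≤ p) (j : ℕ) :
    P (⋂ i ∈ Finset.range j, V i ⁻¹' s) ≤ p ^ j := by
  rw [hind.measure_inter_preimage_eq_mul (Finset.range j) fun i _ => hs]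
  simpa using Finset.prod_le_prod' fun i (_ : i ∈ Finset.range j) => hp i

theorem lintegral_numTrials_le {n : ℕ} {V : ℕ → Ω → ℕ} (hV : ∀ i, AEMeasurable (V i) P)
    (hind : iIndepFun V P) {p : ℝ≥0∞} (hp : ∀ i, P {ω | n < V i ω} ≤ p) :
    ∫⁻ ω, numTrials n (fun i => V i ω) ∂P ≤ (1 - p)⁻¹ := by
  let A (j : ℕ) : Set Ω := ⋂ i ∈ Finset.range j, V i ⁻¹' Set.Ioi n
  have hA (j : ℕ) : NullMeasurableSet (A j) P :=
    Finset.nullMeasurableSet_biInter _ fun i _ => (hV i).nullMeasurable measurableSet_Ioi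
  calc ∫⁻ ω, numTrials n (fun i => V i ω) ∂P
      ≤ ∫⁻ ω, ∑' j : ℕ, (A j).indicator 1 ω ∂P := by
        refine lintegral_mono fun ω => (numTrials_le_tsum n _).trans_eq ?_
        classical
        refine tsum_congr fun j => ?_
        simp only [A, Set.indicator_apply, Set.mem_iInter, Finset.mem_range, Set.mem_preimage,
          Set.mem_Ioi, Pi.one_apply]
    _ = ∑' j : ℕ, P (A j) := by
        refine (lintegral_tsum fun j =>
          (aemeasurable_const (b := (1 : ℝ≥0∞))).indicator₀ (hA j)).trans ?_
        exact tsum_congr fun j => lintegral_indicator_one₀ (hA j)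
    _ ≤ ∑' j : ℕ, p ^ j :=
        ENNReal.tsum_le_tsum (measure_biInter_preimage_le_pow hind measurableSet_Ioi hp)
    _ = (1 - p)⁻¹ := ENNReal.tsum_geometric p

theorem one_sub_le_measureReal_setOf_le [IsProbabilityMeasure P] {V : Ω → ℕ} (hV : AEMeasurable V P)
    {n : ℕ} {ε : ℝ} (hε : 0 ≤ ε) (h : P {ω | n < V ω} ≤ ENNReal.ofReal ε) :
    1 - ε ≤ P.real {ω | V ω ≤ n} := by
  have hreal : P.real (V ⁻¹' Set.Ioi n) ≤ ε := ENNReal.toReal_le_of_le_ofReal hε h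
  have hcompl : {ω | V ω ≤ n} = (V ⁻¹' Set.Ioi n)ᶜ := by
    ext ω
    simp
  rw [hcompl, probReal_compl_eq_one_sub₀ (hV.nullMeasurable measurableSet_Ioi)]
  linarith

end RejectionLoop

theorem mainTheorem5_general {d n : ℕ} (hd : 1 ≤ d) {ε : ℝ} (hε : 2 * d ≤ ε * n.sqrt) :
    (∃! l : ℝ, IsTuned d n l) ∧
    ∀ l : ℝ, IsTuned d n l → ∀ k : ℕ, 1 ≤ k →
      (∀ (Ω : Type*) [MeasurableSpace Ω] (P : Measure Ω) [IsProbabilityMeasure P] (V : Ω → ℕ),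
        HasLaw V (negativeBinomialPos d (l ^ k)) P → 1 - ε ≤ P.real {ω | V ω ≤ n}) ∧
      (∀ (Ω : Type*) [MeasurableSpace Ω] (P : Measure Ω) (V : ℕ → Ω → ℕ),
        (∀ i, HasLaw (V i) (negativeBinomialPos d (l ^ k)) P) → iIndepFun V P →
        ∫⁻ ω, numTrials n (fun i => V i ω) ∂P ≤ (1 - ENNReal.ofReal ε)⁻¹) := by
  have hpos : 0 < ε * n.sqrt := lt_of_lt_of_le (by positivity) hε
  have hε0 : 0 < ε := pos_of_mul_pos_left hpos (Nat.cast_nonneg n.sqrt)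
  have hn : 1 ≤ n := Nat.sqrt_pos.1 (Nat.cast_pos.1 (pos_of_mul_pos_right hpos hε0.le))
  refine ⟨existsUnique_isTuned hd hn, fun l hl k hk => ?_⟩
  have htail := hl.negativeBinomialPos_Ioi_le hd hε (Nat.one_le_iff_ne_zero.1 hk)
  refine ⟨fun Ω _ P _ V hV => ?_, fun Ω _ P V hV hind => ?_⟩
  · exact one_sub_le_measureReal_setOf_le hV.aemeasurable hε0.le
      ((hV.measure_eq measurableSet_Ioi).trans_le htail)
  · exact lintegral_numTrials_le (fun i => (hV i).aemeasurable) hind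
      fun i => ((hV i).measure_eq measurableSet_Ioi).trans_le htail

theorem mainTheorem5 (d : ℕ) (hd : 1 ≤ d) :
    ∀ᶠ n : ℕ in atTop,
      (∃! l : ℝ, IsTuned d n l) ∧
      ∀ l : ℝ, IsTuned d n l →
        (∀ k ∈ Finset.Icc 1 n,
          ∀ (Ω : Type*) [MeasurableSpace Ω] (P : Measure Ω) [IsProbabilityMeasure P] (V : Ω → ℕ),
            HasLaw V (negativeBinomialPos d (l ^ k)) P →
            1 / 2 ≤ P.real {ω | V ω ≤ n}) ∧
        (∀ k : ℕ, 1 ≤ k →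
          ∀ (Ω : Type*) [MeasurableSpace Ω] (P : Measure Ω) [IsProbabilityMeasure P]
            (V : ℕ → Ω → ℕ),
            (∀ i, HasLaw (V i) (negativeBinomialPos d (l ^ k)) P) → iIndepFun V P →
            ∫⁻ ω, numTrials n (fun i => V i ω) ∂P ≤ 2) := by
  filter_upwards [eventually_ge_atTop ((4 * d) ^ 2)] with n hn
  have hε : 2 * d ≤ (1 / 2 : ℝ) * n.sqrt := by
    have : (4 * d : ℝ) ≤ n.sqrt := mod_cast Nat.le_sqrt'.2 hn
    linarith
  obtain ⟨hex, h⟩ := mainTheorem5_general hd hε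
  refine ⟨hex, fun l hl => ⟨fun k hk Ω _ P _ V hV => ?_, fun k hk Ω _ P _ V hV hind => ?_⟩⟩
  · exact (sub_half 1).ge.trans ((h l hl k (Finset.mem_Icc.1 hk).1).1 Ω P V hV)
  · have htwo : (1 - ENNReal.ofReal (1 / 2))⁻¹ = 2 := by
      rw [one_div, ENNReal.ofReal_inv_of_pos two_pos, ENNReal.ofReal_ofNat, ENNReal.one_sub_inv_two,
        inv_inv]
    exact htwo ▸ (h l hl k hk).2 Ω P V hV hind
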